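/- Let $G$ be a (finite-dimensional, real) Lie group, $g$ a left-invariant Riemannian metric on $G$ and $X$ a left-invariant vector field on $G$ with $g(X,X)<1$. Let $F=\alpha+\beta$ be the left-invariant Randers metric defined by $g$ and $X$, that is, $\alpha(x,y)=\sqrt{g_x(y,y)}$ and $\beta(x,y)=g_x(X(x),y)$ for $x\in G$, $y\in T_xG$. Let $f:G\to\mathbb{R}$ be a smooth function and $\tilde F=e^{f}F$. A Finsler metric $F$ on a manifold of dimension $n$ is said to be of Douglas type if its Douglas curvature $$D^{i}_{jkl}=\frac{\partial^3}{\partial y^j\partial y^k\partial y^l}\Big(G^i-\frac{1}{n+1}\frac{\partial G^m}{\partial y^m}\,y^i\Big)$$ vanishes at all $y\neq 0$ in all local coordinates, where $G^i=\frac14 g_F^{il}\big(y^k\frac{\partial^2F^2}{\partial x^k\partial y^l}-\frac{\partial F^2}{\partial x^l}\big)$ are the spray coefficients of $F$ and $(g_F^{il})$ is the inverse of the matrix $\big(\frac12\frac{\partial^2F^2}{\partial y^i\partial y^j}\big)$. If $\tilde F$ is of Douglas type, then for all left-invariant vector fields $Y,Z$ on $G$, $$g(X,[Z,Y])+(Yf)\,g(X,Z)-(Zf)\,g(X,Y)=0$$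 at every point of $G$. -/

import Mathlib

open scoped Manifold ContDiff

noncomputable section

namespace FinslerGeometry

/-! ### Local coordinate expressions, on an open subset of a finite-dimensional vector space

Here `F x y` is the value of a Finsler metric at the point with coordinates `x` on the tangent
vector with components `y`. All expressions are meant at `y ≠ 0`. -/

section Local

variable {E : Type*} [NormedAddCommGroup E] [NormedSpace ℝ E]

/-- The fundamental tensor `g_{ij}(x, y) = ½ ∂²F² / ∂yⁱ∂yʲ`, as a bilinear form. -/
def fundamentalTensor (F : E → E → ℝ) (x y : E) : E →L[ℝ] E →L[ℝ] ℝ :=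
  (1 / 2 : ℝ) • fderiv ℝ (fun y' => fderiv ℝ (fun y'' => F x y'' ^ 2) y') y

/-- The covector with components `yᵏ ∂²F² / ∂xᵏ∂yˡ - ∂F² / ∂xˡ`. -/
def sprayCovector (F : E → E → ℝ) (x y : E) : E →L[ℝ] ℝ :=
  fderiv ℝ (fun x' => fderiv ℝ (fun y' => F x' y' ^ 2) y) x y
    - fderiv ℝ (fun x' => F x' y ^ 2) x

/-- The spray coefficients
`Gⁱ(x, y) = ¼ gⁱˡ (yᵏ ∂²F² / ∂xᵏ∂yˡ - ∂F² / ∂xˡ)`, where `(gⁱˡ)` is the inverse of the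
fundamental tensor, viewed as a map from vectors to covectors. -/
def sprayCoeff (F : E → E → ℝ) (x y : E) : E :=
  (1 / 4 : ℝ) • (fundamentalTensor F x y).inverse (sprayCovector F x y)

/-- The Douglas curvature
`Dⁱ_{jkl}(x, y) = ∂³ / ∂yʲ∂yᵏ∂yˡ (Gⁱ - (1 / (n + 1)) (∂Gᵐ / ∂yᵐ) yⁱ)`, as a trilinear map
with values in vectors; `n` is the dimension and `∂Gᵐ / ∂yᵐ` is the trace of the derivative of
`G` in `y`. -/
def douglasCurvature (F : E → E → ℝ) (x y : E) : E [×3]→L[ℝ] E :=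
  iteratedFDeriv ℝ 3
    (fun y' => sprayCoeff F x y' -
      ((1 / ((Module.finrank ℝ E : ℝ) + 1)) *
        LinearMap.trace ℝ E (fderiv ℝ (sprayCoeff F x) y' : E →ₗ[ℝ] E)) • y') y

end Local

/-! ### Douglas metrics on a manifold -/

section Manifold

variable {E : Type*} [NormedAddCommGroup E] [NormedSpace ℝ E]
  {M : Type*} [TopologicalSpace M] [ChartedSpace E M]

/-- The expression of a function on the tangent bundle in the local coordinate system given by
the chart `e`: the vector with components `y` at the point with coordinates `x` is the image of
`y` under the differential of `e.symm` at `x`. -/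
def inChart (F : (p : M) → TangentSpace 𝓘(ℝ, E) p → ℝ) (e : OpenPartialHomeomorph M E)
    (x y : E) : ℝ :=
  F (e.symm x) (mfderiv 𝓘(ℝ, E) 𝓘(ℝ, E) e.symm x y)

/-- A Finsler metric is of Douglas type if its Douglas curvature vanishes: in every smooth local
coordinate system, at every point of it and every nonzero tangent vector. -/
def IsDouglas (F : (p : M) → TangentSpace 𝓘(ℝ, E) p → ℝ) : Prop :=
  ∀ e ∈ IsManifold.maximalAtlas 𝓘(ℝ, E) ∞ M, ∀ x ∈ e.target, ∀ y : E, y ≠ 0 →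
    douglasCurvature (inChart F e) x y = 0

variable (E M) in
/-- Smooth Riemannian metrics on `M`. -/
abbrev RiemannianMetric [IsManifold 𝓘(ℝ, E) ∞ M] :=
  Bundle.ContMDiffRiemannianMetric 𝓘(ℝ, E) ∞ E (fun p : M => TangentSpace 𝓘(ℝ, E) p)

/-- The function `F = α + β` with `α(x, y) = √(g_x(y, y))` and `β(x, y) = g_x(X(x), y)`. It is a
Randers metric exactly when `g(X, X) < 1` everywhere. -/
def randers [IsManifold 𝓘(ℝ, E) ∞ M] (g : RiemannianMetric E M)
    (X : (p : M) → TangentSpace 𝓘(ℝ, E) p) (p : M) (y : TangentSpace 𝓘(ℝ, E) p) : ℝ :=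
  √(g.inner p y y) + g.inner p (X p) y

/-- The function `e^f F`, conformally related to `F`. -/
def conformal (f : M → ℝ) (F : (p : M) → TangentSpace 𝓘(ℝ, E) p → ℝ)
    (p : M) (y : TangentSpace 𝓘(ℝ, E) p) : ℝ :=
  Real.exp (f p) * F p y

/-- The derivative `Yf` of a function `f` along a vector field `Y`. -/
def lieDeriv (Y : (p : M) → TangentSpace 𝓘(ℝ, E) p) (f : M → ℝ) (p : M) : ℝ :=
  mfderiv 𝓘(ℝ, E) 𝓘(ℝ, ℝ) f p (Y p)

end Manifold

/-! ### Left invariance on a Lie group -/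

section LieGroup

variable {E : Type*} [NormedAddCommGroup E] [NormedSpace ℝ E]
  {G : Type*} [TopologicalSpace G] [ChartedSpace E G] [Group G]

/-- A vector field on a Lie group is left-invariant if `(dL_a)_p X(p) = X(a p)` for all
`a` and `p`. -/
def IsLeftInvariantField (X : (p : G) → TangentSpace 𝓘(ℝ, E) p) : Prop :=
  ∀ a p : G, mfderiv 𝓘(ℝ, E) 𝓘(ℝ, E) (fun q : G => a * q) p (X p) = X (a * p)

/-- A Riemannian metric on a Lie group is left-invariant if all left translations are
isometries. -/
def IsLeftInvariantMetric [IsManifold 𝓘(ℝ, E) ∞ G] (g : RiemannianMetric E G) : Prop :=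
  ∀ (a p : G) (u v : TangentSpace 𝓘(ℝ, E) p),
    g.inner (a * p) (mfderiv 𝓘(ℝ, E) 𝓘(ℝ, E) (fun q : G => a * q) p u)
      (mfderiv 𝓘(ℝ, E) 𝓘(ℝ, E) (fun q : G => a * q) p v) = g.inner p u v

end LieGroup

end FinslerGeometry

end

/-! Write `F̃ = α̃ + β̃`, with `α̃` the norm of `e^{2f} g` and `β̃ = e^f g(X, ·)`. The proof shows
that the Douglas condition forces `β̃` to be closed, and then evaluates `dβ̃ = 0` on left-invariant
fields.

Closedness is pointwise in a chart. By `sprayCoeff_randersNorm`, the spray of a Randers metric is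
`Q(y) + P(y) y + α(y) S(y)`: `Q` is the quadratic Riemannian spray, `P` is homogeneous of degree
one, and `S` is the skew endomorphism dual to half the exterior derivative of the linear part. By
Euler's identity and skewness, the trace correction in the Douglas tensor removes `P(y) y` exactly,
leaving a quadratic map plus `α S'`, where `S'` is `S` minus a multiple of the identity. If its
third derivative vanishes, it is quadratic along every line avoiding the origin; as `α` is not
affine along `y + t v` with `v ⊥ y`, this gives `S' v = 0`, and skewness gives `S v = 0`
(`exteriorDeriv_eq_zero_of_douglasCurvature_eq_zero`).

For left-invariant `U`, `V` the function `g(X, V)` is constant, so `0 = dβ̃(U, V) = U β̃(V) - V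
β̃(U) - β̃([U, V])` becomes, after division by `e^f`, the asserted identity. This is
`apply_lieBracket_frame_of_douglasCurvature_eq_zero`, applied to the left-invariant frame in a
chart. -/

noncomputable section

namespace FinslerGeometry

open Filter Topology

/-! ### Derivatives in `y` and the fundamental tensor of a Randers norm. -/

section Randers

variable {E : Type*} [NormedAddCommGroup E] [NormedSpace ℝ E]

/-- The Randers norm `√(a(y, y)) + b(y)`. -/
def randersNorm (a : E →L[ℝ] E →L[ℝ] ℝ) (b : E →L[ℝ] ℝ) (y : E) : ℝ :=
  √(a y y) + b y

variable {a : E →L[ℝ] E →L[ℝ] ℝ} {b : E →L[ℝ] ℝ} {y : E}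

theorem hasFDerivAt_quadratic (hs : ∀ u v, a u v = a v u) (y : E) :
    HasFDerivAt (fun y => a y y) ((2 : ℝ) • a y) y := by
  have h := a.hasFDerivAt (x := y) |>.clm_apply (hasFDerivAt_id (𝕜 := ℝ) y)
  refine h.congr_fderiv ?_
  ext u
  simp [hs u y]
  ring

theorem hasFDerivAt_sqrt_quadratic (hs : ∀ u v, a u v = a v u) (hy : 0 < a y y) :
    HasFDerivAt (fun y => √(a y y)) ((√(a y y))⁻¹ • a y) y := by
  refine ((hasFDerivAt_quadratic hs y).sqrt hy.ne').congr_fderiv ?_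
  ext u
  simp
  ring

theorem hasFDerivAt_randersNorm (hs : ∀ u v, a u v = a v u) (hy : 0 < a y y) :
    HasFDerivAt (randersNorm a b) ((√(a y y))⁻¹ • a y + b) y :=
  (hasFDerivAt_sqrt_quadratic hs hy).add b.hasFDerivAt

theorem fderiv_randersNorm_sq (hs : ∀ u v, a u v = a v u) (hy : 0 < a y y) :
    fderiv ℝ (fun y => randersNorm a b y ^ 2) y =
      (2 * randersNorm a b y) • ((√(a y y))⁻¹ • a y + b) := by
  rw [((hasFDerivAt_randersNorm (b := b) hs hy).pow 2).fderiv]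
  ext u
  simp

theorem eventually_pos_quadratic (hy : 0 < a y y) : ∀ᶠ z in 𝓝 y, 0 < a z z := by
  have : Continuous fun z => a z z := by fun_prop
  exact this.continuousAt.eventually (lt_mem_nhds hy)

theorem fundamentalTensor_randersNorm {F : E → E → ℝ} {x : E} (hF : F x = randersNorm a b)
    (hs : ∀ u v, a u v = a v u) (hy : 0 < a y y) (u w : E) :
    fundamentalTensor F x y u w =
      randersNorm a b y * (a u w / √(a y y) - a y u * a y w / √(a y y) ^ 3)
        + (a y u / √(a y y) + b u) * (a y w / √(a y y) + b w) := by
  have h1 : (fun z => fderiv ℝ (fun y'' => F x y'' ^ 2) z) =ᶠ[𝓝 y]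
      fun z => (2 * randersNorm a b z) • ((√(a z z))⁻¹ • a z + b) := by
    filter_upwards [eventually_pos_quadratic hy] with z hz
    rw [hF]
    exact fderiv_randersNorm_sq hs hz
  have hα := hasFDerivAt_sqrt_quadratic hs hy
  have hα0 : √(a y y) ≠ 0 := (Real.sqrt_pos.2 hy).ne'
  have hinv : HasFDerivAt (fun z => (√(a z z))⁻¹)
      (-(√(a y y) ^ 2)⁻¹ • ((√(a y y))⁻¹ • a y)) y :=
    (hasDerivAt_inv hα0).comp_hasFDerivAt y hα
  have hF' := hasFDerivAt_randersNorm (b := b) hs hy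
  have h2 := (hF'.const_mul 2).fun_smul ((hinv.fun_smul a.hasFDerivAt).add_const b)
  rw [fundamentalTensor, h1.fderiv_eq, h2.fderiv]
  simp
  field_simp
  ring

end Randers

/-! ### The spray of a Randers metric. -/

section RandersSpray

variable {E : Type*} [NormedAddCommGroup E] [NormedSpace ℝ E]
  {a : E → E →L[ℝ] E →L[ℝ] ℝ} {b : E → E →L[ℝ] ℝ}
  {a' : E →L[ℝ] E →L[ℝ] E →L[ℝ] ℝ} {b' : E →L[ℝ] E →L[ℝ] ℝ} {x y : E}

theorem sprayCovector_randersNorm {F : E → E → ℝ} (hF : ∀ᶠ z in 𝓝 x, F z = randersNorm (a z) (b z))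
    (hs : ∀ᶠ z in 𝓝 x, ∀ u v, a z u v = a z v u) (hy : 0 < a x y y)
    (ha : HasFDerivAt a a' x) (hb : HasFDerivAt b b' x) (w : E) :
    sprayCovector F x y w =
      2 * (randersNorm (a x) (b x) y *
        (a' y y w / √(a x y y) - a x y w * a' y y y / (2 * √(a x y y) ^ 3) + b' y w
          - a' w y y / (2 * √(a x y y)) - b' w y)
        + (a x y w / √(a x y y) + b x w) * (a' y y y / (2 * √(a x y y)) + b' y y)) := by
  have hay : HasFDerivAt (fun z => a z y) (a'.flip y) x :=
    (ha.clm_apply (hasFDerivAt_const y x)).congr_fderiv (by ext u v; simp)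
  have hayy : HasFDerivAt (fun z => a z y y) ((a'.flip y).flip y) x :=
    (hay.clm_apply (hasFDerivAt_const y x)).congr_fderiv (by ext u; simp)
  have hby : HasFDerivAt (fun z => b z y) (b'.flip y) x :=
    (hb.clm_apply (hasFDerivAt_const y x)).congr_fderiv (by ext u; simp)
  have hpos : ∀ᶠ z in 𝓝 x, 0 < a z y y := hayy.continuousAt.eventually (lt_mem_nhds hy)
  have h1 : (fun z => fderiv ℝ (fun y' => F z y' ^ 2) y) =ᶠ[𝓝 x]
      fun z => (2 * (√(a z y y) + b z y)) • ((√(a z y y))⁻¹ • a z y + b z) := by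
    filter_upwards [hF, hs, hpos] with z h hsz hz
    rw [h]
    exact fderiv_randersNorm_sq hsz hz
  have h2 : (fun z => F z y ^ 2) =ᶠ[𝓝 x] fun z => (√(a z y y) + b z y) ^ 2 := by
    filter_upwards [hF] with z h
    rw [h, randersNorm]
  have hα := hayy.sqrt hy.ne'
  have hα0 : √(a x y y) ≠ 0 := (Real.sqrt_pos.2 hy).ne'
  have hinv : HasFDerivAt (fun z => (√(a z y y))⁻¹) _ x :=
    (hasDerivAt_inv hα0).comp_hasFDerivAt x hα
  have hN : HasFDerivAt (fun z => √(a z y y) + b z y) _ x := hα.fun_add hby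
  have h3 := (hN.const_mul 2).fun_smul ((hinv.fun_smul hay).fun_add hb)
  rw [sprayCovector, h1.fderiv_eq, h2.fderiv_eq, h3.fderiv, (hN.pow 2).fderiv, randersNorm]
  simp
  field_simp
  ring

end RandersSpray

section RandersSprayCoeff

variable {E : Type*} [NormedAddCommGroup E] [NormedSpace ℝ E]
  {a : E →L[ℝ] E →L[ℝ] ℝ} {b : E →L[ℝ] ℝ} {x y : E}

/-- Pairing with `y` kills the angular part and leaves `a(y, u)/α + b(u) = 0`. The angular part then
puts `u` on the line of `y`, where the same relation reads `c * randersNorm a b y = 0`. -/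
theorem eq_zero_of_fundamentalTensor_randersNorm_eq_zero {F : E → E → ℝ}
    (hF : F x = randersNorm a b) (hs : ∀ u v, a u v = a v u) (hpos : ∀ u, u ≠ 0 → 0 < a u u)
    (hy : y ≠ 0) (hN : 0 < randersNorm a b y) {u : E} (hu : fundamentalTensor F x y u = 0) :
    u = 0 := by
  have hyy := hpos y hy
  have hα := Real.sqrt_pos.2 hyy
  have hsq : √(a y y) ^ 2 = a y y := Real.sq_sqrt hyy.le
  set α := √(a y y) with hαdef
  have hk (w : E) : randersNorm a b y * (a u w / α - a y u * a y w / α ^ 3)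
      + (a y u / α + b u) * (a y w / α + b w) = 0 := by
    rw [hαdef, ← fundamentalTensor_randersNorm hF hs hyy, hu, zero_apply]
  have hNy : a y y / α + b y = randersNorm a b y := by
    rw [randersNorm, ← hαdef, ← hsq]; field_simp
  have hzero : a u y / α - a y u * a y y / α ^ 3 = 0 := by
    rw [← hsq, hs u y]; field_simp; simp
  have h1 : a y u / α + b u = 0 := by
    have := hk y
    rw [hzero, hNy, mul_zero, zero_add] at this
    exact (mul_eq_zero.1 this).resolve_right hN.ne'
  have h2 (w : E) : a (u - (a y u / a y y) • y) w = 0 := by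
    have := hk w
    rw [h1, zero_mul, add_zero] at this
    have := (mul_eq_zero.1 this).resolve_left hN.ne'
    simp only [map_sub, map_smul, sub_apply, smul_apply, smul_eq_mul]
    rw [← hsq]
    field_simp at this ⊢
    linarith
  have h3 : u = (a y u / a y y) • y := by
    by_contra hne
    exact (hpos _ (sub_ne_zero.2 hne)).ne' (h2 _)
  set c := a y u / a y y
  rw [h3] at h1 ⊢
  have : c * randersNorm a b y = 0 := by
    rw [← hNy, ← h1]; simp; ring
  rw [(mul_eq_zero.1 this).resolve_right hN.ne', zero_smul]

/-- `ContinuousLinearMap.inverse` is zero on non-invertible maps; equality of dimensions makes an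
injective `g` invertible, so here it is the true inverse. -/
theorem inverse_apply_eq_of_injective [FiniteDimensional ℝ E] {g : E →L[ℝ] E →L[ℝ] ℝ}
    (hg : ∀ u, g u = 0 → u = 0) {v : E} {ξ : E →L[ℝ] ℝ} (h : g v = ξ) : g.inverse ξ = v := by
  have hinj : Function.Injective (g : E →ₗ[ℝ] E →L[ℝ] ℝ) := by
    rw [← LinearMap.ker_eq_bot, LinearMap.ker_eq_bot']
    exact hg
  have hdim : Module.finrank ℝ E = Module.finrank ℝ (E →L[ℝ] ℝ) := by
    rw [← (LinearMap.toContinuousLinearMap (𝕜 := ℝ) (E := E) (F' := ℝ)).finrank_eq]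
    exact (Subspace.dual_finrank_eq (K := ℝ) (V := E)).symm
  let e : E ≃L[ℝ] (E →L[ℝ] ℝ) :=
    (LinearEquiv.ofInjectiveOfFinrankEq _ hinj hdim).toContinuousLinearEquiv
  have he : (e : E →L[ℝ] E →L[ℝ] ℝ) = g := by ext u w; rfl
  rw [← h, ← he, ContinuousLinearMap.inverse_equiv]
  simp

end RandersSprayCoeff

section RandersSprayFormula

variable {E : Type*} [NormedAddCommGroup E] [NormedSpace ℝ E]
  {a : E → E →L[ℝ] E →L[ℝ] ℝ} {b : E → E →L[ℝ] ℝ}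
  {a' : E →L[ℝ] E →L[ℝ] E →L[ℝ] ℝ} {b' : E →L[ℝ] E →L[ℝ] ℝ} {x y : E}

/-- The projective factor of a Randers spray: `Q` are the spray coefficients of the Riemannian
part and `S` is half the exterior derivative of the linear part, as an endomorphism. -/
def projectiveFactor (a : E →L[ℝ] E →L[ℝ] ℝ) (b : E →L[ℝ] ℝ) (b' : E →L[ℝ] E →L[ℝ] ℝ)
    (Q : E → E) (S : E →L[ℝ] E) (y : E) : ℝ :=
  (b' y y / 2 - b (Q y) - √(a y y) * b (S y)) / randersNorm a b y

/-- Since the fundamental tensor is nondegenerate, it suffices to lower the index of the claimed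
vector and compare with the spray covector. -/
theorem sprayCoeff_randersNorm [FiniteDimensional ℝ E] {F : E → E → ℝ}
    (hF : ∀ᶠ z in 𝓝 x, F z = randersNorm (a z) (b z))
    (hs : ∀ᶠ z in 𝓝 x, ∀ u v, a z u v = a z v u)
    (hpos : ∀ u, u ≠ 0 → 0 < a x u u)
    (ha : HasFDerivAt a a' x) (hb : HasFDerivAt b b' x)
    {Q : E → E} {S : E →L[ℝ] E}
    (hQ : ∀ y w, a x (Q y) w = a' y y w / 2 - a' w y y / 4)
    (hS : ∀ y w, a x (S y) w = (b' y w - b' w y) / 2)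
    (hy : y ≠ 0) (hN : 0 < randersNorm (a x) (b x) y) :
    sprayCoeff F x y =
      Q y + projectiveFactor (a x) (b x) b' Q S y • y + √(a x y y) • S y := by
  have hyy := hpos y hy
  have hsx := hs.self_of_nhds
  set P := projectiveFactor (a x) (b x) b' Q S y with hP
  have hα := Real.sqrt_pos.2 hyy
  have hsq : √(a x y y) ^ 2 = a x y y := Real.sq_sqrt hyy.le
  rw [sprayCoeff, inverse_apply_eq_of_injective (v := (4 : ℝ) •
    (Q y + P • y + √(a x y y) • S y)) (fun u hu =>
      eq_zero_of_fundamentalTensor_randersNorm_eq_zero hF.self_of_nhds hsx hpos hy hN hu),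
    smul_smul]
  · norm_num
  ext w
  rw [fundamentalTensor_randersNorm hF.self_of_nhds hsx hyy,
    sprayCovector_randersNorm hF hs hyy ha hb]
  have hPN : P * randersNorm (a x) (b x) y
      = b' y y / 2 - b x (Q y) - √(a x y y) * b x (S y) := by
    rw [hP, projectiveFactor, div_mul_cancel₀ _ hN.ne']
  have hN' : randersNorm (a x) (b x) y = √(a x y y) + b x y := rfl
  have hQy : a x y (Q y) = a' y y y / 4 := by rw [hsx, hQ]; ring
  have hSy : a x y (S y) = 0 := by rw [hsx, hS]; ring
  set α := √(a x y y)
  set N := randersNorm (a x) (b x) y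
  simp only [map_add, map_smul, add_apply, smul_apply,
    smul_eq_mul, hQy, hSy, hQ, hS, ← hsq]
  -- The coefficients of `a(y, w)/α + b(w)` on the two sides agree; this is the equation that
  -- determines `P`.
  have e1 : (4 * (a' y y y / 4 + P * α ^ 2 + α * 0)) / α
      + 4 * (b x (Q y) + P * b x y + α * b x (S y)) = 2 * (a' y y y / (2 * α) + b' y y) := by
    have : P * (α + b x y) = b' y y / 2 - b x (Q y) - α * b x (S y) := by rw [← hN', hPN]
    field_simp
    linear_combination 4 * α * this
  rw [e1]
  field_simp
  ring

end RandersSprayFormula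

/-! ### Maps with vanishing third derivative. -/

section ThirdDifference

variable {E V : Type*} [NormedAddCommGroup E] [NormedSpace ℝ E]
  [NormedAddCommGroup V] [NormedSpace ℝ V] [CompleteSpace V]

/-- Taylor's formula along the line, whose integral remainder is zero. -/
theorem exists_quadratic_of_iteratedFDeriv_three_eq_zero {H : E → V} {y v : E}
    (hH : ∀ t : ℝ, ContDiffAt ℝ 3 H (y + t • v))
    (h3 : ∀ t : ℝ, iteratedFDeriv ℝ 3 H (y + t • v) = 0) :
    ∃ c₀ c₁ c₂ : V, ∀ t : ℝ, H (y + t • v) = c₀ + t • c₁ + t ^ 2 • c₂ := by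
  refine ⟨H y, iteratedFDeriv ℝ 1 H y (fun _ => v),
    (2 : ℝ)⁻¹ • iteratedFDeriv ℝ 2 H y (fun _ => v), fun t => ?_⟩
  have := map_add_eq_sum_add_integral_iteratedFDeriv (f := H) (x := y) (y := t • v) (n := 2)
    (fun s _ => by rw [smul_smul]; exact_mod_cast hH _)
  simp only [smul_smul, h3, zero_apply, smul_zero,
    intervalIntegral.integral_zero, add_zero] at this
  rw [this]
  simp only [Finset.sum_range_succ, Finset.sum_range_zero]
  have h1 := (iteratedFDeriv ℝ 1 H y).map_smul_univ (fun _ => t) (fun _ => v)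
  have h2 := (iteratedFDeriv ℝ 2 H y).map_smul_univ (fun _ => t) (fun _ => v)
  simp at h1 h2
  simp [h2, smul_smul, mul_comm]

/-- If `√(a(y, y)) S(y)` differs from a quadratic map by one with vanishing third derivative, then
`S` vanishes on every vector that has a nonzero orthogonal vector. -/
theorem apply_eq_zero_of_iteratedFDeriv_three_eq_zero {a : E →L[ℝ] E →L[ℝ] ℝ}
    (hs : ∀ u v, a u v = a v u) (hpos : ∀ u, u ≠ 0 → 0 < a u u)
    {K : E →L[ℝ] E →L[ℝ] V} {S : E →L[ℝ] V}
    (h3 : ∀ y, y ≠ 0 → iteratedFDeriv ℝ 3 (fun z => K z z + √(a z z) • S z) y = 0)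
    {y v : E} (hy : y ≠ 0) (hv : v ≠ 0) (hyv : a y v = 0) : S v = 0 := by
  have hvy : a v y = 0 := hs v y ▸ hyv
  have hyy := hpos y hy
  have hvv := hpos v hv
  have hquad (t : ℝ) : a (y + t • v) (y + t • v) = a y y + t ^ 2 * a v v := by
    simp [hyv, hvy]; ring
  have hne (t : ℝ) : y + t • v ≠ 0 := by
    intro h
    have := hquad t
    rw [h] at this
    simp at this
    nlinarith [mul_nonneg (sq_nonneg t) hvv.le]
  obtain ⟨c₀, c₁, c₂, hc⟩ := exists_quadratic_of_iteratedFDeriv_three_eq_zero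
    (H := fun z => K z z + √(a z z) • S z) (y := y) (v := v)
    (fun t => by
      have : ContDiffAt ℝ 3 (fun z => a z z) (y + t • v) := by fun_prop
      have := this.sqrt (hpos _ (hne t)).ne'
      fun_prop)
    (fun t => h3 _ (hne t))
  have e1 := hc 1
  have e2 := hc (-1)
  have e3 := hc 3
  have e4 := hc (-3)
  simp only [hquad] at e1 e2 e3 e4
  simp only [map_add, map_smul, add_apply, smul_apply] at e1 e2 e3 e4
  -- `H(3) - H(-3) - 3 (H(1) - H(-1))` kills every polynomial of degree at most two in `t`, hence
  -- also the contribution of `K`. The term `√(a(z, z)) S z` contributes only through its odd part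
  -- `t √(a(y, y) + t² a(v, v)) S v`.
  have key : (6 * (√(a y y + 9 * a v v) - √(a y y + a v v))) • S v = 0 := by
    norm_num at e1 e2 e3 e4
    linear_combination (norm := module) e3 - e4 - (3 : ℝ) • e1 + (3 : ℝ) • e2
  have hlt : √(a y y + a v v) < √(a y y + 9 * a v v) :=
    Real.sqrt_lt_sqrt (by positivity) (by linarith)
  refine (smul_eq_zero.1 key).resolve_left ?_
  exact (mul_pos (by norm_num) (sub_pos.2 hlt)).ne'

end ThirdDifference

/-! ### Homogeneity of the projective factor. -/

section ProjectiveFactor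

variable {E : Type*} [NormedAddCommGroup E] [NormedSpace ℝ E]
  {a : E →L[ℝ] E →L[ℝ] ℝ} {b : E →L[ℝ] ℝ} {b' : E →L[ℝ] E →L[ℝ] ℝ} {B : E →L[ℝ] E →L[ℝ] E}
  {S : E →L[ℝ] E} {y : E}

theorem randersNorm_smul {t : ℝ} (ht : 0 < t) (y : E) :
    randersNorm a b (t • y) = t * randersNorm a b y := by
  have : a (t • y) (t • y) = t ^ 2 * a y y := by simp; ring
  rw [randersNorm, randersNorm, this, Real.sqrt_mul (by positivity), Real.sqrt_sq ht.le]
  simp; ring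

theorem projectiveFactor_smul {t : ℝ} (ht : 0 < t) (y : E) :
    projectiveFactor a b b' (fun z => B z z) S (t • y) =
      t * projectiveFactor a b b' (fun z => B z z) S y := by
  have h : a (t • y) (t • y) = t ^ 2 * a y y := by simp; ring
  rw [projectiveFactor, projectiveFactor, randersNorm_smul ht, h, Real.sqrt_mul (by positivity),
    Real.sqrt_sq ht.le, mul_div_assoc']
  rw [← mul_div_mul_left _ (randersNorm a b y) ht.ne']
  congr 1
  simp; ring

theorem differentiableAt_projectiveFactor (hs : ∀ u v, a u v = a v u) (hy : 0 < a y y)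
    (hN : 0 < randersNorm a b y) :
    DifferentiableAt ℝ (projectiveFactor a b b' (fun z => B z z) S) y := by
  have h1 := (hasFDerivAt_sqrt_quadratic hs hy).differentiableAt
  have h2 := (hasFDerivAt_randersNorm (b := b) hs hy).differentiableAt
  unfold projectiveFactor
  fun_prop (disch := exact hN.ne')

/-- Euler's identity: differentiate degree-one homogeneity along `t ↦ t y` at `t = 1`. -/
theorem fderiv_projectiveFactor_self (hs : ∀ u v, a u v = a v u) (hy : 0 < a y y)
    (hN : 0 < randersNorm a b y) :
    fderiv ℝ (projectiveFactor a b b' (fun z => B z z) S) y y =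
      projectiveFactor a b b' (fun z => B z z) S y := by
  have hd := (differentiableAt_projectiveFactor (b' := b') (B := B) (S := S) hs hy hN).hasFDerivAt
  have hl : HasDerivAt (fun t : ℝ => t • y) y 1 := by
    simpa using (hasDerivAt_id (1 : ℝ)).smul_const y
  rw [← one_smul ℝ y] at hd
  have h1 := hd.comp_hasDerivAt (1 : ℝ) hl
  have h2 : HasDerivAt (fun t : ℝ => t * projectiveFactor a b b' (fun z => B z z) S y)
      (projectiveFactor a b b' (fun z => B z z) S y) 1 := by
    simpa using (hasDerivAt_id (1 : ℝ)).mul_const (projectiveFactor a b b' (fun z => B z z) S y)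
  have h3 := h1.congr_of_eventuallyEq (f₁ := fun t : ℝ =>
      t * projectiveFactor a b b' (fun z => B z z) S y) (by
    filter_upwards [lt_mem_nhds one_pos] with t ht
    exact (projectiveFactor_smul ht y).symm)
  simpa using h3.unique h2

end ProjectiveFactor

/-! ### Vanishing Douglas curvature forces a closed linear part. -/

section Douglas

variable {E : Type*} [NormedAddCommGroup E] [NormedSpace ℝ E] [FiniteDimensional ℝ E]
  {a : E → E →L[ℝ] E →L[ℝ] ℝ} {b : E → E →L[ℝ] ℝ}
  {a' : E →L[ℝ] E →L[ℝ] E →L[ℝ] ℝ} {b' : E →L[ℝ] E →L[ℝ] ℝ} {x y : E}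

/-- The trace of `B(y, ·) + B(·, y)`, as a linear form in `y`. -/
def symmTrace (B : E →L[ℝ] E →L[ℝ] E) : E →L[ℝ] ℝ :=
  LinearMap.toContinuousLinearMap
    (LinearMap.trace ℝ E ∘ₗ ContinuousLinearMap.coeLM ℝ ∘ₗ (B + B.flip : E →L[ℝ] E →L[ℝ] E).toLinearMap)

/-- The derivative of `P(y) y` has trace `n P + dP(y) = (n + 1) P`; in that of `α S`, the rank-one
part has trace `a(y, S y)/α = 0`. -/
theorem trace_fderiv_sprayCoeff_randersNorm {F : E → E → ℝ}
    (hs : ∀ u v, a x u v = a x v u) (hpos : ∀ u, u ≠ 0 → 0 < a x u u)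
    (hN : ∀ u, u ≠ 0 → 0 < randersNorm (a x) (b x) u)
    {B : E →L[ℝ] E →L[ℝ] E} {S : E →L[ℝ] E} (hS : ∀ y, a x (S y) y = 0)
    (hG : ∀ y, y ≠ 0 → sprayCoeff F x y = B y y +
      projectiveFactor (a x) (b x) b' (fun z => B z z) S y • y + √(a x y y) • S y)
    (hy : y ≠ 0) :
    LinearMap.trace ℝ E (fderiv ℝ (sprayCoeff F x) y : E →ₗ[ℝ] E) =
      symmTrace B y + (Module.finrank ℝ E + 1) *
        projectiveFactor (a x) (b x) b' (fun z => B z z) S y +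
        √(a x y y) * LinearMap.trace ℝ E (S : E →ₗ[ℝ] E) := by
  have hev : sprayCoeff F x =ᶠ[𝓝 y] fun y => B y y +
      projectiveFactor (a x) (b x) b' (fun z => B z z) S y • y + √(a x y y) • S y := by
    filter_upwards [isOpen_ne.mem_nhds hy] with z hz using hG z hz
  have hB : HasFDerivAt (fun y => B y y) (B y + B.flip y) y :=
    (B.hasFDerivAt.clm_apply (hasFDerivAt_id (𝕜 := ℝ) y)).congr_fderiv (by ext u; simp)
  have hP := (differentiableAt_projectiveFactor (b' := b') (B := B) (S := S) hs (hpos y hy)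
    (hN y hy)).hasFDerivAt
  have hα := hasFDerivAt_sqrt_quadratic hs (hpos y hy)
  have hid : HasFDerivAt (fun z : E => z) (ContinuousLinearMap.id ℝ E) y := hasFDerivAt_id y
  rw [hev.fderiv_eq, ((hB.fun_add (hP.fun_smul hid)).fun_add
    (hα.fun_smul S.hasFDerivAt)).fderiv]
  have hPy := fderiv_projectiveFactor_self (b' := b') (B := B) (S := S) hs (hpos y hy) (hN y hy)
  have hsr (f : E →L[ℝ] ℝ) (v : E) :
      LinearMap.trace ℝ E (f.smulRight v : E →L[ℝ] E).toLinearMap = f v :=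
    LinearMap.trace_smulRight f.toLinearMap v
  simp only [ContinuousLinearMap.toLinearMap_add, ContinuousLinearMap.toLinearMap_smul, map_add,
    map_smul, hsr, symmTrace]
  simp [hPy, hs y (S y), hS]
  ring

/-- If the Douglas curvature of a Randers metric vanishes at a point, then the exterior derivative
of its linear part vanishes there. -/
theorem exteriorDeriv_eq_zero_of_douglasCurvature_eq_zero {F : E → E → ℝ}
    (hF : ∀ᶠ z in 𝓝 x, F z = randersNorm (a z) (b z))
    (hs : ∀ᶠ z in 𝓝 x, ∀ u v, a z u v = a z v u)
    (hpos : ∀ u, u ≠ 0 → 0 < a x u u)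
    (hN : ∀ u, u ≠ 0 → 0 < randersNorm (a x) (b x) u)
    (ha : HasFDerivAt a a' x) (hb : HasFDerivAt b b' x)
    (hD : ∀ y, y ≠ 0 → douglasCurvature F x y = 0) (u v : E) :
    b' u v = b' v u := by
  have hsx := hs.self_of_nhds
  have hinj : Function.Injective (a x : E →ₗ[ℝ] E →L[ℝ] ℝ) := by
    rw [← LinearMap.ker_eq_bot, LinearMap.ker_eq_bot']
    intro u hu
    by_contra hne
    have : a x u u = 0 := by
      have hu' : a x u = 0 := hu
      rw [hu', zero_apply]
    exact (hpos u hne).ne' this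
  have hdim : Module.finrank ℝ E = Module.finrank ℝ (E →L[ℝ] ℝ) := by
    rw [← (LinearMap.toContinuousLinearMap (𝕜 := ℝ) (E := E) (F' := ℝ)).finrank_eq]
    exact (Subspace.dual_finrank_eq (K := ℝ) (V := E)).symm
  let A : E ≃L[ℝ] (E →L[ℝ] ℝ) :=
    (LinearEquiv.ofInjectiveOfFinrankEq _ hinj hdim).toContinuousLinearEquiv
  have hA (ξ : E →L[ℝ] ℝ) : a x (A.symm ξ) = ξ := A.apply_symm_apply ξ
  let S : E →L[ℝ] E := (A.symm : (E →L[ℝ] ℝ) →L[ℝ] E) ∘L ((2 : ℝ)⁻¹ • (b' - b'.flip))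
  have hS (y w : E) : a x (S y) w = (b' y w - b' w y) / 2 := by
    simp only [S, ContinuousLinearMap.comp_apply, ContinuousLinearEquiv.coe_coe, hA]
    simp; ring
  let fl : (E →L[ℝ] E →L[ℝ] ℝ) →L[ℝ] (E →L[ℝ] E →L[ℝ] ℝ) :=
    (ContinuousLinearMap.flipₗᵢ ℝ E E ℝ).toContinuousLinearEquiv
  let C : (E →L[ℝ] E →L[ℝ] ℝ) →L[ℝ] (E →L[ℝ] E) :=
    ContinuousLinearMap.compL ℝ E (E →L[ℝ] ℝ) E (A.symm : (E →L[ℝ] ℝ) →L[ℝ] E)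
  let B : E →L[ℝ] E →L[ℝ] E := (2 : ℝ)⁻¹ • (C ∘L a') - (4 : ℝ)⁻¹ • (C ∘L fl ∘L a'.flip)
  have hB (y w : E) : a x (B y y) w = a' y y w / 2 - a' w y y / 4 := by
    simp only [B, C, sub_apply, smul_apply, ContinuousLinearMap.comp_apply,
      ContinuousLinearMap.compL_apply, ContinuousLinearEquiv.coe_coe, map_sub, map_smul, hA]
    simp [fl]; ring
  have hSy (y : E) : a x (S y) y = 0 := by rw [hS]; ring
  have hG (y : E) (hy : y ≠ 0) := sprayCoeff_randersNorm hF hs hpos ha hb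
    (Q := fun z => B z z) (S := S) hB hS hy (hN y hy)
  set c : ℝ := 1 / ((Module.finrank ℝ E : ℝ) + 1) with hc
  have hc1 : c * ((Module.finrank ℝ E : ℝ) + 1) = 1 := by rw [hc]; field_simp
  set τ := LinearMap.trace ℝ E (S : E →ₗ[ℝ] E)
  -- Since `c (n + 1) = 1`, the projective term cancels. `K` collects the quadratic terms and `S'`
  -- the terms multiplied by `α`.
  let K : E →L[ℝ] E →L[ℝ] E :=
    B - (c • symmTrace B).smulRight (ContinuousLinearMap.id ℝ E)
  let S' : E →L[ℝ] E := S - (c * τ) • ContinuousLinearMap.id ℝ E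
  have h3 (y : E) (hy : y ≠ 0) :
      iteratedFDeriv ℝ 3 (fun z => K z z + √(a x z z) • S' z) y = 0 := by
    rw [← hD y hy, douglasCurvature]
    refine (Filter.EventuallyEq.iteratedFDeriv ℝ ?_ 3).self_of_nhds
    filter_upwards [isOpen_ne.mem_nhds hy] with z hz
    rw [trace_fderiv_sprayCoeff_randersNorm hsx hpos hN hSy hG hz, hG z hz]
    simp only [K, S', sub_apply, ContinuousLinearMap.smulRight_apply, smul_apply, smul_eq_mul,
      ContinuousLinearMap.id_apply]
    rw [← hc]
    linear_combination (norm := module)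
      (projectiveFactor (a x) (b x) b' (fun z => B z z) S z * hc1) • z
  by_cases hv : v = 0
  · simp [hv]
  by_cases hex : ∃ y, y ≠ 0 ∧ a x y v = 0
  · obtain ⟨y, hy, hyv⟩ := hex
    have h0 := apply_eq_zero_of_iteratedFDeriv_three_eq_zero hsx hpos h3 hy hv hyv
    have h1 : S v = (c * τ) • v := by simpa [S', sub_eq_zero] using h0
    -- Skewness, `a(S v, v) = 0`, makes the multiple `c * τ` vanish.
    have h2 := hSy v
    rw [h1] at h2
    have h4 : c * τ = 0 := by
      simpa [(hpos v hv).ne'] using h2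
    have h5 := hS v u
    rw [h1, h4] at h5
    simp at h5
    linarith
  -- With no nonzero vector orthogonal to `v`, every `u` is a multiple of `v` and symmetry is
  -- automatic.
  · push Not at hex
    have : u - (a x u v / a x v v) • v = 0 := by
      by_contra hne
      refine hex _ hne ?_
      have := (hpos v hv).ne'
      simp
      field_simp
      ring
    rw [sub_eq_zero.1 this]
    simp

end Douglas

/-! ### Closedness expressed in a moving frame. -/

section Frame

variable {E : Type*} [NormedAddCommGroup E] [NormedSpace ℝ E] [FiniteDimensional ℝ E]

theorem differentiableAt_clm_of_apply {D V : Type*} [NormedAddCommGroup D] [NormedSpace ℝ D]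
    [NormedAddCommGroup V] [NormedSpace ℝ V] {T : D → E →L[ℝ] V} {x : D}
    (h : ∀ v, DifferentiableAt ℝ (fun z => T z v) x) : DifferentiableAt ℝ T x := by
  have hd : Module.finrank ℝ E = Module.finrank ℝ (Fin (Module.finrank ℝ E) → ℝ) :=
    (Module.finrank_fin_fun ℝ).symm
  let e₁ := ContinuousLinearEquiv.ofFinrankEq hd
  let e₂ := (e₁.arrowCongr (1 : V ≃L[ℝ] V)).trans (ContinuousLinearEquiv.piRing _)
  rw [← Function.id_comp T, ← e₂.symm_comp_self]
  exact e₂.symm.differentiableAt.comp x (differentiableAt_pi.2 fun i => h _)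

theorem differentiableAt_inverse_of_isInvertible {T : E → E →L[ℝ] E} {x : E}
    (hi : (T x).IsInvertible) (hT : DifferentiableAt ℝ T x) :
    DifferentiableAt ℝ (fun z => (T z).inverse) x := by
  have := FiniteDimensional.complete ℝ E
  obtain ⟨e, he⟩ := hi
  have h := (contDiffAt_map_inverse (𝕜 := ℝ) (n := 1) e).differentiableAt one_ne_zero
  rw [he] at h
  exact h.comp x hT

/-- If in a moving frame `T` a metric is conformal to a fixed Randers norm, and its Douglas
curvature vanishes, then the commutators of the frame are determined by the conformal factor. -/
theorem apply_lieBracket_frame_of_douglasCurvature_eq_zero {F : E → E → ℝ} {T : E → E →L[ℝ] E}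
    {φ : E → ℝ} {q : E →L[ℝ] E →L[ℝ] ℝ} {c : E →L[ℝ] ℝ} {x : E}
    (hT : DifferentiableAt ℝ T x) (hφ : DifferentiableAt ℝ φ x)
    (hi : ∀ᶠ z in 𝓝 x, (T z).IsInvertible)
    (hF : ∀ᶠ z in 𝓝 x, ∀ v, F z (T z v) = Real.exp (φ z) * randersNorm q c v)
    (hq : ∀ u v, q u v = q v u) (hpos : ∀ u, u ≠ 0 → 0 < q u u)
    (hN : ∀ u, u ≠ 0 → 0 < randersNorm q c u)
    (hD : ∀ y, y ≠ 0 → douglasCurvature F x y = 0) (u v : E) :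
    c ((T x).inverse (VectorField.lieBracket ℝ (fun z => T z u) (fun z => T z v) x)) =
      fderiv ℝ φ x (T x u) * c v - fderiv ℝ φ x (T x v) * c u := by
  set θ : E → E →L[ℝ] E := fun z => (T z).inverse
  have hθd : DifferentiableAt ℝ θ x :=
    differentiableAt_inverse_of_isInvertible hi.self_of_nhds hT
  have hTθ {z : E} (h : (T z).IsInvertible) (y : E) : T z (θ z y) = y := h.self_apply_inverse y
  have hθT {z : E} (h : (T z).IsInvertible) (y : E) : θ z (T z y) = y := h.inverse_apply_self y
  -- The coframe `θ` turns the fixed norm into coordinate expressions; the conformal factor enters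
  -- squared in the quadratic part and once in the linear part.
  let a : E → E →L[ℝ] E →L[ℝ] ℝ := fun z => (Real.exp (φ z) ^ 2) • q.bilinearComp (θ z) (θ z)
  let b : E → E →L[ℝ] ℝ := fun z => Real.exp (φ z) • c ∘L θ z
  have ha (z u v : E) : a z u v = Real.exp (φ z) ^ 2 * q (θ z u) (θ z v) := by simp [a]
  have hb (z u : E) : b z u = Real.exp (φ z) * c (θ z u) := by simp [b]
  have had : DifferentiableAt ℝ a x := by
    refine differentiableAt_clm_of_apply fun u => differentiableAt_clm_of_apply fun v => ?_
    simp only [ha]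
    fun_prop
  have hbd : DifferentiableAt ℝ b x := by
    refine differentiableAt_clm_of_apply fun u => ?_
    simp only [hb]
    fun_prop
  have hab (z y : E) : randersNorm (a z) (b z) y = Real.exp (φ z) * randersNorm q c (θ z y) := by
    rw [randersNorm, ha, hb, Real.sqrt_mul (by positivity), Real.sqrt_sq (Real.exp_pos _).le,
      randersNorm]
    ring
  have hθ0 (y : E) (hy : y ≠ 0) : θ x y ≠ 0 := by
    intro h
    apply hy
    rw [← hTθ hi.self_of_nhds y, h, map_zero]
  have hclosed := exteriorDeriv_eq_zero_of_douglasCurvature_eq_zero (F := F) (a := a) (b := b)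
    (by
      filter_upwards [hF, hi] with z h1 h2
      ext y
      rw [hab, ← h1, hTθ h2])
    (Eventually.of_forall fun z u v => by rw [ha, ha, hq])
    (fun u hu => by rw [ha]; exact mul_pos (by positivity) (hpos _ (hθ0 u hu)))
    (fun u hu => by rw [hab]; exact mul_pos (by positivity) (hN _ (hθ0 u hu)))
    had.hasFDerivAt hbd.hasFDerivAt hD
  -- The product rule for `b(T v) = e^φ c(v)`. Antisymmetrizing removes the derivative of `b`, by
  -- closedness, and leaves `b` of the bracket.
  have hpair (v w : E) : fderiv ℝ b x w (T x v) + b x (fderiv ℝ (fun z => T z v) x w) =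
      Real.exp (φ x) * fderiv ℝ φ x w * c v := by
    have h1 : (fun z => b z (T z v)) =ᶠ[𝓝 x] fun z => Real.exp (φ z) * c v := by
      filter_upwards [hi] with z hz
      rw [hb, hθT hz]
    have hTv : DifferentiableAt ℝ (fun z => T z v) x := by fun_prop
    have h2 := h1.fderiv_eq (𝕜 := ℝ)
    have h4 := (hφ.hasFDerivAt.exp.mul_const (c v)).fderiv
    rw [(hbd.hasFDerivAt.clm_apply hTv.hasFDerivAt).fderiv, h4] at h2
    have h3 := congrArg (fun L : E →L[ℝ] ℝ => L w) h2
    simp at h3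
    linarith
  have e1 := hpair v (T x u)
  have e2 := hpair u (T x v)
  have e3 := hclosed (T x u) (T x v)
  have key : b x (VectorField.lieBracket ℝ (fun z => T z u) (fun z => T z v) x) =
      Real.exp (φ x) * (fderiv ℝ φ x (T x u) * c v - fderiv ℝ φ x (T x v) * c u) := by
    rw [VectorField.lieBracket, map_sub]
    linarith
  rw [hb] at key
  exact mul_left_cancel₀ (Real.exp_pos _).ne' key

end Frame

/-! ### Left-invariant frames in charts. -/

section Chart

variable {E : Type*} [NormedAddCommGroup E] [NormedSpace ℝ E]
  {M : Type*} [TopologicalSpace M] [ChartedSpace E M]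

theorem preimage_univ_inter_range (p : M) :
    (extChartAt 𝓘(ℝ, E) p).symm ⁻¹' Set.univ ∩ Set.range 𝓘(ℝ, E) = Set.univ := by
  simp

theorem isInvertible_mfderiv_extChartAt_symm [IsManifold 𝓘(ℝ, E) 1 M] {p : M} {x : E}
    (hx : x ∈ (extChartAt 𝓘(ℝ, E) p).target) :
    (mfderiv 𝓘(ℝ, E) 𝓘(ℝ, E) (extChartAt 𝓘(ℝ, E) p).symm x).IsInvertible := by
  have := isInvertible_mfderivWithin_extChartAt_symm hx
  rwa [ModelWithCorners.range_eq_univ, mfderivWithin_univ] at this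

end Chart

section LeftInvariant

variable {E : Type*} [NormedAddCommGroup E] [NormedSpace ℝ E]
  {G : Type*} [TopologicalSpace G] [ChartedSpace E G] [Group G]

theorem IsLeftInvariantField.eq_mulInvariantVectorField {Y : (p : G) → TangentSpace 𝓘(ℝ, E) p}
    (hY : IsLeftInvariantField Y) (r : G) : Y r = mulInvariantVectorField (Y 1) r := by
  -- The tangent space depends on the base point, so `r * 1 = r` cannot simply be rewritten; a free
  -- point `s` allows `subst`.
  have h (s : G) (hs : s = r * 1) : (Y s : E) = (mfderiv 𝓘(ℝ, E) 𝓘(ℝ, E) (fun t : G => r * t) 1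
      (Y 1) : E) := by
    subst hs
    exact (hY r 1).symm
  exact h r (mul_one r).symm

theorem IsLeftInvariantMetric.inner_mulInvariantVectorField [IsManifold 𝓘(ℝ, E) ∞ G]
    {g : RiemannianMetric E G} (hg : IsLeftInvariantMetric g) (r : G)
    (u v : TangentSpace 𝓘(ℝ, E) (1 : G)) :
    g.inner r (mulInvariantVectorField u r) (mulInvariantVectorField v r) = g.inner 1 u v := by
  have h (s : G) (hs : s = r * 1) :
      g.inner s ((mfderiv 𝓘(ℝ, E) 𝓘(ℝ, E) (fun t : G => r * t) 1 u : E) :)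
        ((mfderiv 𝓘(ℝ, E) 𝓘(ℝ, E) (fun t : G => r * t) 1 v : E) :) = g.inner 1 u v := by
    subst hs
    exact hg r 1 u v
  exact h r (mul_one r).symm

theorem isInvertible_mfderiv_mul_left [LieGroup 𝓘(ℝ, E) (minSmoothness ℝ 3) G] (r s : G) :
    (mfderiv 𝓘(ℝ, E) 𝓘(ℝ, E) (fun t : G => r * t) s).IsInvertible := by
  have M : minSmoothness ℝ 3 ≠ 0 := lt_of_lt_of_le (by simp) le_minSmoothness |>.ne'
  have h (r' s' : G) : MDifferentiableAt 𝓘(ℝ, E) 𝓘(ℝ, E) (fun t : G => r' * t) s' :=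
    contMDiff_mul_left.contMDiffAt.mdifferentiableAt M
  refine ContinuousLinearMap.IsInvertible.of_inverse
    (g := mfderiv 𝓘(ℝ, E) 𝓘(ℝ, E) (fun t : G => r⁻¹ * t) (r * s)) ?_ ?_
  · have e : (fun t : G => r * t) ∘ (fun t => r⁻¹ * t) = id := by ext t; simp
    have := mfderiv_comp (r * s) (h r (r⁻¹ * (r * s))) (h r⁻¹ (r * s))
    rw [e, mfderiv_id, inv_mul_cancel_left] at this
    exact this.symm
  · have e : (fun t : G => r⁻¹ * t) ∘ (fun t => r * t) = id := by ext t; simp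
    have := mfderiv_comp s (h r⁻¹ (r * s)) (h r s)
    rw [e, mfderiv_id] at this
    exact this.symm

variable (E) in
/-- The left-invariant frame of a Lie group in the chart at `p`: the vector `v` of the Lie algebra
is sent to the coordinate expression at `x` of the left-invariant vector field it generates. -/
def leftInvariantFrame (p : G) (x : E) : E →L[ℝ] E :=
  ((mfderiv 𝓘(ℝ, E) 𝓘(ℝ, E) (extChartAt 𝓘(ℝ, E) p).symm x).inverse : E →L[ℝ] E) ∘L
    (mfderiv 𝓘(ℝ, E) 𝓘(ℝ, E) (fun t : G => (extChartAt 𝓘(ℝ, E) p).symm x * t) 1 : E →L[ℝ] E)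

theorem leftInvariantFrame_apply (p : G) (v : E) :
    (fun x => leftInvariantFrame E p x v) =
      VectorField.mpullbackWithin 𝓘(ℝ, E) 𝓘(ℝ, E) (extChartAt 𝓘(ℝ, E) p).symm
        (mulInvariantVectorField (I := 𝓘(ℝ, E)) (G := G) v) (Set.range 𝓘(ℝ, E)) := by
  ext x
  rw [VectorField.mpullbackWithin_apply, ModelWithCorners.range_eq_univ, mfderivWithin_univ]
  rfl

theorem mfderiv_leftInvariantFrame [IsManifold 𝓘(ℝ, E) 1 G] {p : G} {x : E}
    (hx : x ∈ (extChartAt 𝓘(ℝ, E) p).target) (v : E) :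
    mfderiv 𝓘(ℝ, E) 𝓘(ℝ, E) (extChartAt 𝓘(ℝ, E) p).symm x (leftInvariantFrame E p x v) =
      mulInvariantVectorField (I := 𝓘(ℝ, E)) (G := G) v ((extChartAt 𝓘(ℝ, E) p).symm x) :=
  (isInvertible_mfderiv_extChartAt_symm hx).self_apply_inverse _

variable [LieGroup 𝓘(ℝ, E) (minSmoothness ℝ 3) G]

theorem isInvertible_leftInvariantFrame [IsManifold 𝓘(ℝ, E) 1 G] {p : G} {x : E}
    (hx : x ∈ (extChartAt 𝓘(ℝ, E) p).target) : (leftInvariantFrame E p x).IsInvertible :=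
  (isInvertible_mfderiv_extChartAt_symm hx).inverse.comp
    (isInvertible_mfderiv_mul_left ((extChartAt 𝓘(ℝ, E) p).symm x) 1)

theorem differentiableAt_leftInvariantFrame [FiniteDimensional ℝ E] [IsManifold 𝓘(ℝ, E) 2 G]
    (p : G) : DifferentiableAt ℝ (leftInvariantFrame E p) (extChartAt 𝓘(ℝ, E) p p) := by
  have := FiniteDimensional.complete ℝ E
  refine differentiableAt_clm_of_apply fun v => differentiableWithinAt_univ.1 ?_
  rw [leftInvariantFrame_apply, ← preimage_univ_inter_range p]
  exact MDifferentiableWithinAt.differentiableWithinAt_mpullbackWithin_vectorField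
    (mdifferentiableAt_mulInvariantVectorField (I := 𝓘(ℝ, E)) (G := G) v
      (g := p)).mdifferentiableWithinAt

/-- The manifold bracket is by definition the chart bracket pushed forward; the frame carries its
Lie algebra components back to the same tangent vector. -/
theorem mlieBracket_mulInvariantVectorField_eq [IsManifold 𝓘(ℝ, E) 1 G] (p : G) (u v : E) :
    VectorField.mlieBracket 𝓘(ℝ, E) (mulInvariantVectorField (I := 𝓘(ℝ, E)) (G := G) u)
        (mulInvariantVectorField (I := 𝓘(ℝ, E)) (G := G) v) p =
      mulInvariantVectorField (I := 𝓘(ℝ, E)) (G := G)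
        ((leftInvariantFrame E p (extChartAt 𝓘(ℝ, E) p p)).inverse
          (VectorField.lieBracket ℝ (fun x => leftInvariantFrame E p x u)
            (fun x => leftInvariantFrame E p x v) (extChartAt 𝓘(ℝ, E) p p))) p := by
  set x := extChartAt 𝓘(ℝ, E) p p
  have hxt : x ∈ (extChartAt 𝓘(ℝ, E) p).target := mem_extChartAt_target p
  have hxp : (extChartAt 𝓘(ℝ, E) p).symm x = p := extChartAt_to_inv p
  set ζ : E := VectorField.lieBracket ℝ (fun x => leftInvariantFrame E p x u)
    (fun x => leftInvariantFrame E p x v) x with hζ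
  set w : E := (leftInvariantFrame E p x).inverse ζ with hw
  have h0 : VectorField.lieBracketWithin ℝ
      (VectorField.mpullbackWithin 𝓘(ℝ, E) 𝓘(ℝ, E) (extChartAt 𝓘(ℝ, E) p).symm
        (mulInvariantVectorField (I := 𝓘(ℝ, E)) (G := G) u) (Set.range 𝓘(ℝ, E)))
      (VectorField.mpullbackWithin 𝓘(ℝ, E) 𝓘(ℝ, E) (extChartAt 𝓘(ℝ, E) p).symm
        (mulInvariantVectorField (I := 𝓘(ℝ, E)) (G := G) v) (Set.range 𝓘(ℝ, E)))
      ((extChartAt 𝓘(ℝ, E) p).symm ⁻¹' Set.univ ∩ Set.range 𝓘(ℝ, E)) x = ζ := by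
    rw [← leftInvariantFrame_apply, ← leftInvariantFrame_apply, preimage_univ_inter_range]
    exact congrFun VectorField.lieBracketWithin_univ x
  have h1 (r : G) (hr : r = (extChartAt 𝓘(ℝ, E) p).symm x) :
      (mfderiv 𝓘(ℝ, E) 𝓘(ℝ, E) (extChartAt 𝓘(ℝ, E) p) r
        (mulInvariantVectorField (I := 𝓘(ℝ, E)) (G := G) w r) : E) = ζ := by
    subst hr
    have h2 := mfderiv_extChartAt_comp_mfderivWithin_extChartAt_symm hxt
    rw [ModelWithCorners.range_eq_univ, mfderivWithin_univ] at h2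
    have h3 := mfderiv_leftInvariantFrame hxt w
    have h4 : leftInvariantFrame E p x w = ζ :=
      (isInvertible_leftInvariantFrame hxt).self_apply_inverse ζ
    rw [h4] at h3
    rw [← h3]
    exact congrArg (fun L : E →L[ℝ] E => L ζ) h2
  refine Eq.trans (congrArg (fun z : E => ((mfderiv 𝓘(ℝ, E) 𝓘(ℝ, E) (extChartAt 𝓘(ℝ, E) p)
    p).inverse z : E)) h0) ?_
  exact (isInvertible_mfderiv_extChartAt (I := 𝓘(ℝ, E)) (mem_extChartAt_source p)
    ).inverse_apply_eq.2 (h1 p hxp.symm).symm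

end LeftInvariant

/-- Cauchy–Schwarz, from the nonnegative square of `q(u, u) X - q(X, u) u`, gives `|q(X, u)| <
√(q(u, u))`. -/
theorem randersNorm_pos {E : Type*} [NormedAddCommGroup E] [NormedSpace ℝ E]
    {q : E →L[ℝ] E →L[ℝ] ℝ} (hs : ∀ u v, q u v = q v u) (hpos : ∀ u, u ≠ 0 → 0 < q u u)
    {X : E} (hX : q X X < 1) {u : E} (hu : u ≠ 0) : 0 < randersNorm q (q X) u := by
  have huu := hpos u hu
  have hw : 0 ≤ q (q u u • X - q X u • u) (q u u • X - q X u • u) := by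
    by_cases h : q u u • X - q X u • u = 0
    · rw [h]; simp
    · exact (hpos _ h).le
  have hexp : q (q u u • X - q X u • u) (q u u • X - q X u • u)
      = q u u * (q u u * q X X - q X u ^ 2) := by
    simp [hs u X]; ring
  rw [hexp] at hw
  have h1 : q X u ^ 2 < q u u := by nlinarith [nonneg_of_mul_nonneg_right hw huu]
  have h2 : |q X u| < √(q u u) := Real.lt_sqrt (abs_nonneg _) |>.2 (by rwa [sq_abs])
  rw [randersNorm]
  linarith [neg_abs_le (q X u)]

section LeftInvariant

variable {E : Type*} [NormedAddCommGroup E] [NormedSpace ℝ E]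
  {G : Type*} [TopologicalSpace G] [ChartedSpace E G] [Group G]

/-- In this frame `g` and `g(X, ·)` have constant coefficients, so only the conformal factor depends
on the point. -/
theorem inChart_conformal_randers_leftInvariantFrame [IsManifold 𝓘(ℝ, E) ∞ G]
    [IsManifold 𝓘(ℝ, E) 1 G]
    {g : RiemannianMetric E G} (hg : IsLeftInvariantMetric g)
    {X : (p : G) → TangentSpace 𝓘(ℝ, E) p} (hX : IsLeftInvariantField X) (f : G → ℝ) {p : G} {x : E}
    (hx : x ∈ (extChartAt 𝓘(ℝ, E) p).target) (v : E) :
    inChart (conformal f (randers g X)) (chartAt E p) x (leftInvariantFrame E p x v) =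
      Real.exp (f ((extChartAt 𝓘(ℝ, E) p).symm x)) *
        randersNorm (E := E) (g.inner 1) (g.inner 1 (X 1)) v := by
  have h : inChart (conformal f (randers g X)) (chartAt E p) x (leftInvariantFrame E p x v) =
      conformal f (randers g X) ((extChartAt 𝓘(ℝ, E) p).symm x)
        (mfderiv 𝓘(ℝ, E) 𝓘(ℝ, E) (extChartAt 𝓘(ℝ, E) p).symm x (leftInvariantFrame E p x v)) := rfl
  have h1 (r : G) : conformal f (randers g X) r (mulInvariantVectorField v r) = Real.exp (f r) *
      (√(g.inner 1 v v) + g.inner 1 (X 1) v) := by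
    have h2 := hg.inner_mulInvariantVectorField r v v
    have h3 := hg.inner_mulInvariantVectorField r (X 1) v
    rw [← hX.eq_mulInvariantVectorField] at h3
    rw [conformal, randers]
    exact congrArg₂ (fun s t : ℝ => Real.exp (f r) * (√s + t)) h2 h3
  rw [h, mfderiv_leftInvariantFrame hx]
  exact h1 _

end LeftInvariant

end FinslerGeometry

end

/-! ### Closedness evaluated on left-invariant fields. -/

theorem proposition3p3 {E : Type*} [NormedAddCommGroup E] [NormedSpace ℝ E]
    [FiniteDimensional ℝ E]
    {G : Type*} [TopologicalSpace G] [ChartedSpace E G] [Group G] [LieGroup 𝓘(ℝ, E) ∞ G]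
    (g : FinslerGeometry.RiemannianMetric E G)
    (hg : FinslerGeometry.IsLeftInvariantMetric g)
    (X : (p : G) → TangentSpace 𝓘(ℝ, E) p)
    (hX : FinslerGeometry.IsLeftInvariantField X)
    (hX1 : ∀ p : G, g.inner p (X p) (X p) < 1)
    (f : G → ℝ) (hf : ContMDiff 𝓘(ℝ, E) 𝓘(ℝ, ℝ) ∞ f)
    (hD : FinslerGeometry.IsDouglas
      (FinslerGeometry.conformal f (FinslerGeometry.randers g X)))
    (Y Z : (p : G) → TangentSpace 𝓘(ℝ, E) p)
    (hY : FinslerGeometry.IsLeftInvariantField Y)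
    (hZ : FinslerGeometry.IsLeftInvariantField Z) (p : G) :
    g.inner p (X p) (VectorField.mlieBracket 𝓘(ℝ, E) Z Y p)
      + FinslerGeometry.lieDeriv Y f p * g.inner p (X p) (Z p)
      - FinslerGeometry.lieDeriv Z f p * g.inner p (X p) (Y p) = 0 := by
  open FinslerGeometry in
  have : IsManifold 𝓘(ℝ, E) 1 G := IsManifold.of_le (n := ∞) (by simp)
  have : IsManifold 𝓘(ℝ, E) 2 G := IsManifold.of_le (n := ∞)
    (WithTop.coe_le_coe.2 le_top : ((2 : ℕ∞) : ℕ∞ω) ≤ ∞)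
  have : LieGroup 𝓘(ℝ, E) (minSmoothness ℝ 3) G := by
    rw [minSmoothness_of_isRCLikeNormedField]
    exact LieGroup.of_le (n := ∞) (WithTop.coe_le_coe.2 le_top : ((3 : ℕ∞) : ℕ∞ω) ≤ ∞)
  set x := extChartAt 𝓘(ℝ, E) p p
  have hxt : x ∈ (extChartAt 𝓘(ℝ, E) p).target := mem_extChartAt_target p
  have hxp : (extChartAt 𝓘(ℝ, E) p).symm x = p := extChartAt_to_inv p
  have htarget : ∀ᶠ z in nhds x, z ∈ (extChartAt 𝓘(ℝ, E) p).target := extChartAt_target_mem_nhds p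
  have hfd : MDifferentiableAt 𝓘(ℝ, E) 𝓘(ℝ, ℝ) f ((extChartAt 𝓘(ℝ, E) p).symm x) :=
    hf.contMDiffAt.mdifferentiableAt (by simp)
  have hed : MDifferentiableAt 𝓘(ℝ, E) 𝓘(ℝ, E) (extChartAt 𝓘(ℝ, E) p).symm x :=
    mdifferentiableAt_of_isInvertible_mfderiv (isInvertible_mfderiv_extChartAt_symm hxt)
  have hφ : DifferentiableAt ℝ (fun z => f ((extChartAt 𝓘(ℝ, E) p).symm z)) x :=
    (hfd.comp x hed).differentiableAt
  let q : E →L[ℝ] E →L[ℝ] ℝ := g.inner 1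
  have hq (u v : E) : q u v = q v u := g.symm 1 u v
  have hpos (u : E) (hu : u ≠ 0) : 0 < q u u := g.pos 1 u hu
  have key := apply_lieBracket_frame_of_douglasCurvature_eq_zero
    (F := inChart (conformal f (randers g X)) (chartAt E p)) (T := leftInvariantFrame E p)
    (φ := fun z => f ((extChartAt 𝓘(ℝ, E) p).symm z)) (q := q) (c := q (X 1)) (x := x)
    (differentiableAt_leftInvariantFrame p) hφ
    (htarget.mono fun z hz => isInvertible_leftInvariantFrame hz)
    (htarget.mono fun z hz => inChart_conformal_randers_leftInvariantFrame hg hX f hz)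
    hq hpos (fun u hu => randersNorm_pos hq hpos (hX1 1) hu)
    (hD _ (IsManifold.chart_mem_maximalAtlas p) x (mem_chart_target E p)) (Z 1) (Y 1)
  have hderiv {V : (p : G) → TangentSpace 𝓘(ℝ, E) p} (hV : IsLeftInvariantField V) :
      fderiv ℝ (fun z => f ((extChartAt 𝓘(ℝ, E) p).symm z)) x (leftInvariantFrame E p x (V 1)) =
        lieDeriv V f p := by
    have h1 := mfderiv_comp x hfd hed
    have h2 := mfderiv_leftInvariantFrame hxt (V 1)
    have h3 (r : G) (hr : r = (extChartAt 𝓘(ℝ, E) p).symm x) : lieDeriv V f r =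
        (mfderiv 𝓘(ℝ, E) 𝓘(ℝ, ℝ) f ((extChartAt 𝓘(ℝ, E) p).symm x)
          (mulInvariantVectorField (I := 𝓘(ℝ, E)) (G := G) (V 1)
            ((extChartAt 𝓘(ℝ, E) p).symm x)) : ℝ) := by
      subst hr
      rw [lieDeriv, hV.eq_mulInvariantVectorField]
    rw [h3 p hxp.symm, ← h2, ← mfderiv_eq_fderiv]
    exact congrArg (fun L : E →L[ℝ] ℝ => L (leftInvariantFrame E p x (V 1))) h1
  have hpair {V : (p : G) → TangentSpace 𝓘(ℝ, E) p} (hV : IsLeftInvariantField V) :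
      g.inner p (X p) (V p) = q (X 1) (V 1) := by
    rw [hX.eq_mulInvariantVectorField, hV.eq_mulInvariantVectorField,
      hg.inner_mulInvariantVectorField]
    rfl
  have hbracket : g.inner p (X p) (VectorField.mlieBracket 𝓘(ℝ, E) Z Y p) =
      q (X 1) ((leftInvariantFrame E p x).inverse
        (VectorField.lieBracket ℝ (fun z => leftInvariantFrame E p z (Z 1))
          (fun z => leftInvariantFrame E p z (Y 1)) x)) := by
    have hZ' : Z = mulInvariantVectorField (Z 1) := funext hZ.eq_mulInvariantVectorField
    have hY' : Y = mulInvariantVectorField (Y 1) := funext hY.eq_mulInvariantVectorField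
    have h1 : VectorField.mlieBracket 𝓘(ℝ, E) Z Y p =
        VectorField.mlieBracket 𝓘(ℝ, E) (mulInvariantVectorField (Z 1))
          (mulInvariantVectorField (Y 1)) p := by
      rw [← hZ', ← hY']
    rw [hX.eq_mulInvariantVectorField]
    exact (congrArg _ (h1.trans (mlieBracket_mulInvariantVectorField_eq (E := E) p (Z 1) (Y 1)))).trans
      (hg.inner_mulInvariantVectorField p (X 1) _)
  rw [hbracket, key, hderiv hY, hderiv hZ, hpair hY, hpair hZ]
  ring
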